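/- Let $G$ be a countable discrete group that is amenable, i.e. there are nonempty finite sets $F_n\subset G$ with $|gF_n\triangle F_n|/|F_n|\to 0$ for every $g\in G$. Let $(X,\mathcal B,\mu)$ be a Lebesgue space (a probability space isomorphic mod $0$, after completion, to $\mathbb R$ with a Borel probability measure), and let $T:G\times X\to X$, $(g,x)\mapsto gx$, be an action of $G$ on $X$ by $\mu$-preserving maps. A partition $\alpha$ of $X$ is measurable if there are countably many measurable unions of elements of $\alpha$ that separate any two distinct elements of $\alpha$. For a measurable partition $\mathcal C$ let $X/\mathcal C$ be the factor space, with the image measure $\mu_{\mathcal C}$, and let $\{\mu_B\}_{B\in X/\mathcal C}$ be the (essentially unique) canonical system of conditional measures: for $\mu_{\mathcal C}$-a.e. $B$, $\mu_B$ makes $B$ a Lebesgue space, and for every $E\in\mathcal B$ the set $E\cap B$ is $\mu_B$-measurable for a.e. $B$, the function $B\mapsto\mu_B(E\cap B)$ is ($\mu_{\mathcal C}$-a.e.) measurable, and $\mu(E)=\int_{X/\mathcal C}\mu_B(E\cap B)\,d\mu_{\mathcal C}(B)$. The entropy of a measurable partition $\xi$ of a probability space $(Y,\nu)$ is $H_\nu(\xi)=-\sum_l\nu(A_l)\log\nu(A_l)$,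 where $A_1,A_2,\dots$ are the elements of positive measure, if these cover $Y$ up to a null set, and $H_\nu(\xi)=+\infty$ otherwise. The mean conditional entropy of a measurable partition $\alpha$ given $\mathcal C$ is $$H_\mu(\alpha|\mathcal C)=\int_{X/\mathcal C}H_{\mu_B}(\alpha|_B)\,d\mu_{\mathcal C}(B)\in[0,\infty].$$ Let $\mathcal A\subseteq\mathcal B$ be a sub-$\sigma$-algebra with $gA\in\mathcal A$ for all $g\in G$, $A\in\mathcal A$, and let $\mathcal C$ be a measurable partition that corresponds to $\mathcal A$, i.e. the measurable unions of elements of $\mathcal C$ and the sets in $\mathcal A$ have the same classes modulo $\mu$-null sets. Let $\alpha$ be a measurable partition with $H_\mu(\alpha|\mathcal C)<\infty$, and for finite $F\subset G$ let $\alpha^F=\bigvee_{g\in F}g^{-1}\alpha$. Then $H_\mu(\alpha^F|\mathcal C)<\infty$ for every nonempty finite $F\subset G$, and $$\frac1{|F|}H_\mu(\alpha^F|\mathcal C)$$ converges to a unique limit $h^{\mathcal A}_\mu(T,\alpha)$ as $F$ becomes more and more invariant: for every $\varepsilon>0$ there are a finite $K\subset G$ and $\delta>0$ such that $\bigl|\frac1{|F|}H_\mu(\alpha^F|\mathcal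 C)-h^{\mathcal A}_\mu(T,\alpha)\bigr|<\varepsilon$ for all nonempty finite $F\subset G$ with $|gF\triangle F|\le\delta|F|$ for all $g\in K$. Moreover $$h^{\mathcal A}_\mu(T,\alpha)=\inf_F\frac1{|F|}H_\mu(\alpha^F|\mathcal C),$$ where $F$ ranges over the nonempty finite subsets of $G$. -/

import Mathlib

open MeasureTheory Filter Topology
open scoped ENNReal

namespace AmenableEntropy

section Groups

variable {G : Type*} [Group G]

open scoped Classical in
/-- `|gF △ F|`, the number of elements of the symmetric difference of `gF` and `F`. -/
noncomputable def boundaryCard (g : G) (F : Finset G) : ℕ :=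
  (symmDiff (F.image (fun s => g * s)) F).card

/-- `F` is a Følner sequence: nonempty finite sets with `|gFₙ △ Fₙ| / |Fₙ| → 0` for all `g`. -/
def IsFolnerSeq (F : ℕ → Finset G) : Prop :=
  (∀ n, (F n).Nonempty) ∧
    ∀ g : G, Tendsto (fun n => (boundaryCard g (F n) : ℝ) / ((F n).card : ℝ)) atTop (𝓝 0)

/-- The nonempty finite set `F` is `(K, δ)`-invariant. -/
def IsInvariantUpTo (K : Finset G) (δ : ℝ) (F : Finset G) : Prop :=
  F.Nonempty ∧ ∀ g ∈ K, (boundaryCard g F : ℝ) ≤ δ * (F.card : ℝ)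

variable (G) in
/-- A discrete group is amenable if it admits a Følner sequence. -/
def IsAmenable : Prop := ∃ F : ℕ → Finset G, IsFolnerSeq F

open scoped Classical in
variable (G) in
/-- The filter on finite subsets of `G` expressing "as `F` becomes more and more invariant":
a property holds eventually if, for some finite `K` and some `δ > 0`, it holds for all nonempty
finite `(K, δ)`-invariant sets `F`. -/
def moreInvariant : Filter (Finset G) where
  sets := {S | ∃ (K : Finset G) (δ : ℝ), 0 < δ ∧ ∀ F, IsInvariantUpTo K δ F → F ∈ S}
  univ_sets := ⟨∅, 1, one_pos, fun _ _ => trivial⟩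
  sets_of_superset := by
    rintro S S' ⟨K, δ, hδ, h⟩ hS
    exact ⟨K, δ, hδ, fun F hF => hS (h F hF)⟩
  inter_sets := by
    rintro S S' ⟨K, δ, hδ, h⟩ ⟨K', δ', hδ', h'⟩
    refine ⟨K ∪ K', min δ δ', lt_min hδ hδ', fun F hF => ⟨h F ⟨hF.1, fun g hg => ?_⟩,
      h' F ⟨hF.1, fun g hg => ?_⟩⟩⟩
    · exact (hF.2 g (Finset.mem_union_left _ hg)).trans
        (mul_le_mul_of_nonneg_right (min_le_left _ _) (Nat.cast_nonneg _))
    · exact (hF.2 g (Finset.mem_union_right _ hg)).trans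
        (mul_le_mul_of_nonneg_right (min_le_right _ _) (Nat.cast_nonneg _))

end Groups

/-- Lebesgue spaces in the sense of Rokhlin: probability spaces isomorphic mod 0 to `ℝ` with (the
completion of) a Borel probability measure. Measurability of the isomorphism is understood with
respect to the completed σ-algebras, so that both complete spaces and standard Borel probability
spaces are covered. -/
def IsLebesgueSpace {X : Type*} [MeasurableSpace X] (μ : Measure X) : Prop :=
  IsProbabilityMeasure μ ∧
    ∃ (ν : Measure ℝ) (X₀ : Set (NullMeasurableSpace X μ)) (Y₀ : Set (NullMeasurableSpace ℝ ν))
      (e : X₀ ≃ᵐ Y₀), μ.completion X₀ᶜ = 0 ∧ ν.completion Y₀ᶜ = 0 ∧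
        MeasurePreserving e (μ.completion.comap Subtype.val) (ν.completion.comap Subtype.val)

/-! Partitions of `X` are equivalence relations (`Setoid X`); the elements of the partition are
the equivalence classes, and the factor space `X/C` is `Quotient C`, whose σ-algebra in Mathlib
consists of the sets with measurable preimage in `X`. -/

section Partitions

variable {X : Type*}

/-- `B` is a union of elements of the partition `C` (a `C`-set). -/
def IsSaturated (C : Setoid X) (B : Set X) : Prop := ∀ x y, C x y → x ∈ B → y ∈ B

/-- Rokhlin's measurable partitions: some countable family of measurable `C`-sets separates any
two distinct elements of `C`. -/
def IsMeasurablePartition [MeasurableSpace X] (C : Setoid X) : Prop :=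
  ∃ B : ℕ → Set X, (∀ n, MeasurableSet (B n) ∧ IsSaturated C (B n)) ∧
    ∀ x y, ¬ C x y → ∃ n, (x ∈ B n ∧ y ∉ B n) ∨ (x ∉ B n ∧ y ∈ B n)

/-- The partition `C` corresponds to the sub-σ-algebra `𝒜`: the classes mod `μ`-null sets of the
measurable `C`-sets are exactly the classes of the sets in `𝒜`. -/
def Corresponds (𝒜 : MeasurableSpace X) [mX : MeasurableSpace X] (μ : Measure X) (C : Setoid X) :
    Prop :=
  (∀ A, MeasurableSet[𝒜] A → ∃ B, MeasurableSet[mX] B ∧ IsSaturated C B ∧ A =ᵐ[μ] B) ∧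
    ∀ B, MeasurableSet[mX] B → IsSaturated C B → ∃ A, MeasurableSet[𝒜] A ∧ B =ᵐ[μ] A

/-- The element of the partition `α` labelled by the point `q` of the factor space. -/
def cell (α : Setoid X) (q : Quotient α) : Set X := {x | Quotient.mk α x = q}

open scoped Classical in
/-- The entropy of the partition `α` of the probability space `(X, μ)`: `- ∑ μ(A) log μ(A)` if
the elements of positive measure cover `X` up to a null set, and `∞` otherwise. Elements of
measure zero contribute `0` to the sum. -/
noncomputable def entropy [MeasurableSpace X] (μ : Measure X) (α : Setoid X) : ℝ≥0∞ :=
  if μ (⋃ q ∈ {q : Quotient α | 0 < μ (cell α q)}, cell α q)ᶜ = 0 then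
    ∑' q : Quotient α, ENNReal.ofReal (Real.negMulLog (μ (cell α q)).toReal)
  else ∞

/-- The measure of the factor space `X/C`. -/
noncomputable def factorMeasure [MeasurableSpace X] (μ : Measure X) (C : Setoid X) :
    Measure (Quotient C) :=
  μ.map (Quotient.mk C)

/-- A measure on each element of the partition `C`, each with a σ-algebra of its own. (If `X` is
complete, every subset of a null element of `C` is measurable in `X`, so the trace of the
σ-algebra of `X` on an element of `C` is in general too large to carry the conditional measure.) -/
structure MeasureSystem (C : Setoid X) where
  /-- the σ-algebra on the element of `C` -/
  σ : ∀ c : Quotient C, MeasurableSpace (cell C c)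
  /-- the measure on the element of `C` -/
  meas : ∀ c : Quotient C, @Measure (cell C c) (σ c)

/-- `S` is a canonical system of conditional measures of `μ` associated with `C`. -/
structure IsCanonicalSystem [MeasurableSpace X] (μ : Measure X) (C : Setoid X)
    (S : MeasureSystem C) : Prop where
  lebesgue : ∀ᵐ c ∂factorMeasure μ C, @IsLebesgueSpace (cell C c) (S.σ c) (S.meas c)
  measurable_trace : ∀ B : Set X, MeasurableSet B →
    ∀ᵐ c ∂factorMeasure μ C, MeasurableSet[S.σ c] ((Subtype.val : cell C c → X) ⁻¹' B)
  aemeasurable : ∀ B : Set X, MeasurableSet B →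
    AEMeasurable (fun c => S.meas c ((Subtype.val : cell C c → X) ⁻¹' B)) (factorMeasure μ C)
  disintegration : ∀ B : Set X, MeasurableSet B →
    μ B = ∫⁻ c, S.meas c ((Subtype.val : cell C c → X) ⁻¹' B) ∂factorMeasure μ C

open scoped Classical in
/-- The (essentially unique) canonical system of conditional measures of `μ` associated with `C`;
the zero system in the case, which does not occur for a measurable partition of a Lebesgue space,
that there is none. -/
noncomputable def canonicalSystem [MeasurableSpace X] (μ : Measure X) (C : Setoid X) :
    MeasureSystem C :=
  if h : ∃ S, IsCanonicalSystem μ C S then h.choose else ⟨fun _ => ⊤, fun _ => 0⟩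

/-- The mean conditional entropy `H_μ(α|C)`: the integral over `X/C` of the entropy of the
restriction of `α` to the elements of `C` with respect to the conditional measures. -/
noncomputable def condEntropy [MeasurableSpace X] (μ : Measure X) (α C : Setoid X) : ℝ≥0∞ :=
  ∫⁻ c, @entropy (cell C c) ((canonicalSystem μ C).σ c) ((canonicalSystem μ C).meas c)
    (α.comap Subtype.val) ∂factorMeasure μ C

end Partitions

section Actions

variable {G X : Type*} [Group G] [MulAction G X]

/-- `α^F`, the join of the partitions `g⁻¹α`, `g ∈ F`: two points `x`, `y` lie in the same element
iff `gx` and `gy` lie in the same element of `α` for every `g ∈ F`. -/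
def joinOver (α : Setoid X) (F : Finset G) : Setoid X :=
  ⨅ g ∈ F, α.comap (fun x => g • x)

/-- `H_μ(α^F|C) / |F|`. -/
noncomputable def meanEntropy [MeasurableSpace X] (μ : Measure X) (α C : Setoid X)
    (F : Finset G) : ℝ≥0∞ :=
  condEntropy μ (joinOver α F) C / (F.card : ℝ≥0∞)

variable (G) in
/-- The conditional entropy of the action with respect to `α`, given the σ-algebra corresponding
to `C`: the limit of `H_μ(α^F|C) / |F|` as `F` becomes more and more invariant. -/
noncomputable def actionEntropy [MeasurableSpace X] (μ : Measure X) (α C : Setoid X) : ℝ≥0∞ :=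
  limUnder (moreInvariant G) (meanEntropy μ α C)

end Actions

end AmenableEntropy

/-!
# The entropy of an amenable group action relative to a factor

Write `h(F) = H_μ(α^F | C)`. The convergence of `h(F) / |F|` to its infimum follows from three
properties of `h`: it is monotone, it is submodular (`h(A ∪ B) + h(A ∩ B) ≤ h(A) + h(B)`), and it
is invariant under right translations (`h(Kt) = h(K)`). Submodularity gives Shearer's inequality
(`shearer`): if finite sets cover each point of `F` at least `r` times, then `r h(F)` is at most
the sum of the values of `h` on these sets. The translates `Kt`, `t ∈ K⁻¹F`, cover each point of
`F` exactly `|K|` times, whence `|K| h(F) ≤ |K⁻¹F| h(K)` (`card_mul_le_card_inv_mul_mul`). As `F`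
becomes more and more invariant, `|K⁻¹F| / |F| → 1`, so the upper limit of `h(F) / |F|` is at most
`h(K) / |K|` for every nonempty `K` (`tendsto_average_iInf`). No quasi-tilings are needed. The
choice `K = {1}` gives `h(F) ≤ |F| h({1})`, hence the finiteness of `h`.

The entropy of a partition `ξ` of a probability space is the integral of the information function
`y ↦ -log m(ξ(y))` (`entropy_eq_lintegral_surprisal`). By monotone convergence, it is the supremum
of the entropies of the finite partitions generated by the first `k` sets of a separating sequence
(`entropy_eq_iSup_labelEntropy`). This reduces everything to finite partitions, given by labellings
`f : X → ι`, and settles the measurability of the entropy as a function on the factor space.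
For finite partitions submodularity is the nonnegativity of the conditional mutual information
(`labelEntropy_submodular`), applied to each conditional measure.

For invariance, the conditional probabilities `x ↦ μ_{C(x)}(E)` are characterized a.e. by their
integrals over the sets that agree mod `μ` with sets of `𝒜`, and these sets are permuted by the
action although `C` itself is invariant only mod null sets
(`IsCanonicalSystem.condMass_preimage_ae_eq`).
-/

namespace AmenableEntropy

/-! ### Entropy of partitions of a probability space -/

section LabelEntropy

variable {Y : Type*} {mY : MeasurableSpace Y}

/-- The information content `-log t` of an event of probability `t ≤ 1`, with value `∞` at
`t = 0`. -/
noncomputable def surprisal (t : ℝ≥0∞) : ℝ≥0∞ := (-ENNReal.log t).toENNReal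

lemma surprisal_antitone : Antitone surprisal := fun _ _ h =>
  EReal.toENNReal_le_toENNReal (EReal.neg_le_neg_iff.2 (ENNReal.log_monotone h))

@[simp] lemma surprisal_zero : surprisal 0 = ∞ := by simp [surprisal]

lemma continuous_surprisal : Continuous surprisal :=
  (continuous_neg.comp ENNReal.continuous_log).ereal_toENNReal

lemma surprisal_mul_self {t : ℝ≥0∞} (ht : t ≠ ∞) :
    surprisal t * t = ENNReal.ofReal (Real.negMulLog t.toReal) := by
  rcases eq_or_ne t 0 with rfl | h0
  · simp
  · have h : 0 ≤ t.toReal := ENNReal.toReal_nonneg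
    rw [surprisal, ENNReal.log_pos_real h0 ht, ← EReal.coe_neg, EReal.real_coe_toENNReal,
      Real.negMulLog]
    conv_lhs => rw [← ENNReal.ofReal_toReal ht]
    rw [ENNReal.toReal_ofReal h, ← ENNReal.ofReal_mul' h]
    congr 1
    ring

/-- The entropy is the integral of the information function `y ↦ -log m(ξ(y))`. -/
lemma entropy_eq_lintegral_surprisal (m : Measure Y) [IsFiniteMeasure m] (ξ : Setoid Y)
    (hξ : ∀ q, MeasurableSet (cell ξ q)) :
    entropy m ξ = ∫⁻ y, surprisal (m (cell ξ (Quotient.mk ξ y))) ∂m := by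
  classical
  set P : Set (Quotient ξ) := {q | 0 < m (cell ξ q)} with hP
  have hdisj : Pairwise (Function.onFun Disjoint (cell ξ)) := by
    intro q q' hqq'
    refine Set.disjoint_left.2 fun x hx hx' => hqq' ?_
    exact (show Quotient.mk ξ x = q from hx).symm.trans hx'
  have hcount : P.Countable := Measure.countable_meas_pos_of_disjoint_iUnion hξ hdisj
  have hUm : MeasurableSet (⋃ q ∈ P, cell ξ q) := MeasurableSet.biUnion hcount fun q _ => hξ q
  have hcell : ∀ q, ∫⁻ y in cell ξ q, surprisal (m (cell ξ (Quotient.mk ξ y))) ∂m =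
      ENNReal.ofReal (Real.negMulLog (m (cell ξ q)).toReal) := by
    intro q
    rw [setLIntegral_congr_fun (g := fun _ => surprisal (m (cell ξ q))) (hξ q), setLIntegral_const,
      surprisal_mul_self (measure_ne_top _ _)]
    intro y hy
    have : Quotient.mk ξ y = q := hy
    simp only [this]
  rw [entropy]
  split_ifs with h
  · rw [← lintegral_add_compl _ hUm, setLIntegral_measure_zero _ _ h, add_zero,
      lintegral_biUnion hcount (fun q _ => hξ q) (hdisj.set_pairwise _)]
    simp_rw [hcell]
    rw [tsum_subtype P (fun q => ENNReal.ofReal (Real.negMulLog (m (cell ξ q)).toReal))]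
    refine tsum_congr fun q => ?_
    by_cases hq : q ∈ P
    · rw [Set.indicator_of_mem hq]
    · have : m (cell ξ q) = 0 := by simpa [hP] using hq
      rw [Set.indicator_of_notMem hq, this]
      simp
  · symm
    rw [eq_top_iff]
    calc ∞ = ∫⁻ _ in (⋃ q ∈ P, cell ξ q)ᶜ, ∞ ∂m := by
          rw [setLIntegral_const, ENNReal.top_mul h]
      _ = ∫⁻ y in (⋃ q ∈ P, cell ξ q)ᶜ, surprisal (m (cell ξ (Quotient.mk ξ y))) ∂m := by
          refine setLIntegral_congr_fun hUm.compl fun y hy => ?_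
          have : m (cell ξ (Quotient.mk ξ y)) = 0 := by
            by_contra h0
            exact hy (Set.mem_biUnion (x := Quotient.mk ξ y) (pos_iff_ne_zero.2 h0) rfl)
          simp only [this, surprisal_zero]
      _ ≤ _ := setLIntegral_le_lintegral _ _

/-- The Shannon entropy of the finite partition into the fibres of a labelling `f`. -/
noncomputable def labelEntropy {ι : Type*} [Fintype ι] (m : Measure Y) (f : Y → ι) : ℝ :=
  ∑ i, Real.negMulLog (m.real (f ⁻¹' {i}))

variable {ι κ τ : Type*} [Fintype ι] [Fintype κ] [Fintype τ]

lemma labelEntropy_nonneg (m : Measure Y) [IsProbabilityMeasure m] (f : Y → ι) :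
    0 ≤ labelEntropy m f :=
  Finset.sum_nonneg fun _ _ => Real.negMulLog_nonneg measureReal_nonneg measureReal_le_one

/-- `a (log b + log c - log d - log a) ≤ b c / d - a`, the pointwise form of the nonnegativity of
conditional mutual information. -/
lemma negMulLog_submodular_term {a b c d : ℝ} (ha : 0 ≤ a) (hb : a ≤ b) (hc : a ≤ c) (hd : b ≤ d) :
    Real.negMulLog a + a * (Real.log b + Real.log c - Real.log d) ≤ b * c / d - a := by
  rcases ha.eq_or_lt with rfl | ha
  · have : 0 ≤ b * c / d := div_nonneg (mul_nonneg hb hc) (hb.trans hd)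
    simpa using this
  · have hb0 : 0 < b := ha.trans_le hb
    have hc0 : 0 < c := ha.trans_le hc
    have hd0 : 0 < d := hb0.trans_le hd
    have hbc : 0 < b * c / d := div_pos (mul_pos hb0 hc0) hd0
    have h := Real.log_le_sub_one_of_pos (div_pos hbc ha)
    rw [Real.log_div hbc.ne' ha.ne', Real.log_div (mul_pos hb0 hc0).ne' hd0.ne',
      Real.log_mul hb0.ne' hc0.ne'] at h
    have h2 := mul_le_mul_of_nonneg_left h ha.le
    have h3 : a * (b * c / d / a - 1) = b * c / d - a := by field_simp
    rw [h3] at h2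
    rw [Real.negMulLog]
    linarith

/-- Submodularity of the Shannon entropy of a joint distribution `p` of three variables:
`H(x,y,z) + H(z) ≤ H(x,z) + H(y,z)`. -/
lemma sum_negMulLog_submodular (p : ι → κ → τ → ℝ) (hp : ∀ i j k, 0 ≤ p i j k) :
    ∑ i, ∑ j, ∑ k, Real.negMulLog (p i j k) + ∑ k, Real.negMulLog (∑ i, ∑ j, p i j k) ≤
      ∑ i, ∑ k, Real.negMulLog (∑ j, p i j k) + ∑ j, ∑ k, Real.negMulLog (∑ i, p i j k) := by
  set b : ι → τ → ℝ := fun i k => ∑ j, p i j k with hb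
  set c : κ → τ → ℝ := fun j k => ∑ i, p i j k with hc
  set d : τ → ℝ := fun k => ∑ i, ∑ j, p i j k with hd
  have hb0 : ∀ i k, 0 ≤ b i k := fun i k => Finset.sum_nonneg fun j _ => hp i j k
  have hd0 : ∀ k, 0 ≤ d k := fun k => Finset.sum_nonneg fun i _ => hb0 i k
  have hdc : ∀ k, d k = ∑ j, c j k := fun k => Finset.sum_comm
  have key : ∀ k, ∑ i, ∑ j, (Real.negMulLog (p i j k) +
      p i j k * (Real.log (b i k) + Real.log (c j k) - Real.log (d k))) ≤ 0 := by
    intro k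
    calc _ ≤ ∑ i, ∑ j, (b i k * c j k / d k - p i j k) := by
          refine Finset.sum_le_sum fun i _ => Finset.sum_le_sum fun j _ => ?_
          refine negMulLog_submodular_term (hp i j k) ?_ ?_ ?_
          · exact Finset.single_le_sum (f := fun j => p i j k) (fun j _ => hp i j k)
              (Finset.mem_univ j)
          · exact Finset.single_le_sum (f := fun i => p i j k) (fun i _ => hp i j k)
              (Finset.mem_univ i)
          · exact Finset.single_le_sum (f := fun i => b i k) (fun i _ => hb0 i k)
              (Finset.mem_univ i)
      _ = d k * d k / d k - d k := by
          simp_rw [Finset.sum_sub_distrib, ← Finset.sum_div, ← Finset.mul_sum, ← Finset.sum_mul,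
            ← hdc]
          rfl
      _ = 0 := by
          rcases eq_or_ne (d k) 0 with h | h
          · simp [h]
          · field_simp; simp
  have e1 : ∀ k, ∑ i, Real.negMulLog (b i k) = -∑ i, ∑ j, p i j k * Real.log (b i k) := by
    intro k
    simp [Real.negMulLog, ← Finset.sum_mul, hb]
  have e2 : ∀ k, ∑ j, Real.negMulLog (c j k) = -∑ i, ∑ j, p i j k * Real.log (c j k) := by
    intro k
    rw [Finset.sum_comm]
    simp [Real.negMulLog, ← Finset.sum_mul, hc]
  have e3 : ∀ k, Real.negMulLog (d k) = -∑ i, ∑ j, p i j k * Real.log (d k) := by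
    intro k
    simp [Real.negMulLog, ← Finset.sum_mul, hd]
  have e4 : ∑ i, ∑ j, ∑ k, Real.negMulLog (p i j k) = ∑ k, ∑ i, ∑ j, Real.negMulLog (p i j k) := by
    rw [Finset.sum_comm]
    simp_rw [Finset.sum_comm (s := (Finset.univ : Finset ι))]
    rw [Finset.sum_comm]
  rw [e4, Finset.sum_comm (s := (Finset.univ : Finset ι)),
    Finset.sum_comm (s := (Finset.univ : Finset κ)), ← Finset.sum_add_distrib,
    ← Finset.sum_add_distrib]
  refine Finset.sum_le_sum fun k _ => ?_
  rw [e1, e2, e3]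
  have := key k
  simp only [mul_add, mul_sub, Finset.sum_add_distrib, Finset.sum_sub_distrib] at this
  linarith

variable [MeasurableSpace ι] [MeasurableSingletonClass ι] [MeasurableSpace κ]
  [MeasurableSingletonClass κ]

lemma ofReal_labelEntropy (m : Measure Y) [IsProbabilityMeasure m] {f : Y → ι}
    (hf : Measurable f) :
    ENNReal.ofReal (labelEntropy m f) = ∫⁻ y, surprisal (m (f ⁻¹' {f y})) ∂m := by
  rw [labelEntropy, ENNReal.ofReal_sum_of_nonneg fun _ _ =>
    Real.negMulLog_nonneg measureReal_nonneg measureReal_le_one,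
    ← lintegral_map (f := fun i => surprisal (m (f ⁻¹' {i}))) (measurable_of_finite _) hf,
    lintegral_fintype]
  refine Finset.sum_congr rfl fun i _ => ?_
  rw [Measure.map_apply hf (measurableSet_singleton i), surprisal_mul_self (measure_ne_top _ _)]
  rfl

lemma labelEntropy_mono (m : Measure Y) [IsProbabilityMeasure m] {f : Y → ι} {f' : Y → κ}
    (hf : Measurable f) (hf' : Measurable f') (h : ∀ x y, f' x = f' y → f x = f y) :
    labelEntropy m f ≤ labelEntropy m f' := by
  rw [← ENNReal.ofReal_le_ofReal_iff (labelEntropy_nonneg m f'), ofReal_labelEntropy m hf,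
    ofReal_labelEntropy m hf']
  exact lintegral_mono fun y => surprisal_antitone (measure_mono fun x hx => h x y hx)

lemma measureReal_eq_sum_inter_fibre (m : Measure Y) [IsFiniteMeasure m] {u : Y → ι}
    (hu : Measurable u) (A : Set Y) : m.real A = ∑ i, m.real (A ∩ u ⁻¹' {i}) := by
  have h1 := sum_measureReal_preimage_singleton (μ := m.restrict A) (f := u) Finset.univ
    (fun s _ => hu (measurableSet_singleton s))
  simp only [Finset.coe_univ, Set.preimage_univ, measureReal_restrict_apply_univ] at h1
  rw [← h1]
  refine Finset.sum_congr rfl fun s _ => ?_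
  rw [measureReal_restrict_apply (hu (measurableSet_singleton s)), Set.inter_comm]

/-- Submodularity of entropy: `H(f,g,h) + H(h) ≤ H(f,h) + H(g,h)`. -/
lemma labelEntropy_submodular (m : Measure Y) [IsProbabilityMeasure m] {f : Y → ι} {g : Y → κ}
    (h : Y → τ) (hf : Measurable f) (hg : Measurable g) :
    labelEntropy m (fun y => (f y, g y, h y)) + labelEntropy m h ≤
      labelEntropy m (fun y => (f y, h y)) + labelEntropy m (fun y => (g y, h y)) := by
  set p : ι → κ → τ → ℝ := fun i j k => m.real ((fun y => (f y, g y, h y)) ⁻¹' {(i, j, k)}) with hp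
  have hfh : ∀ i k, m.real ((fun y => (f y, h y)) ⁻¹' {(i, k)}) = ∑ j, p i j k := by
    intro i k
    rw [measureReal_eq_sum_inter_fibre m hg]
    refine Finset.sum_congr rfl fun j _ => ?_
    rw [hp]
    congr 1
    ext y
    simp only [Set.mem_inter_iff, Set.mem_preimage, Set.mem_singleton_iff, Prod.mk.injEq]
    tauto
  have hgh : ∀ j k, m.real ((fun y => (g y, h y)) ⁻¹' {(j, k)}) = ∑ i, p i j k := by
    intro j k
    rw [measureReal_eq_sum_inter_fibre m hf]
    refine Finset.sum_congr rfl fun i _ => ?_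
    rw [hp]
    congr 1
    ext y
    simp only [Set.mem_inter_iff, Set.mem_preimage, Set.mem_singleton_iff, Prod.mk.injEq]
    tauto
  have hk : ∀ k, m.real (h ⁻¹' {k}) = ∑ i, ∑ j, p i j k := by
    intro k
    rw [measureReal_eq_sum_inter_fibre m hf]
    refine Finset.sum_congr rfl fun i _ => ?_
    rw [← hfh]
    congr 1
    ext y
    simp only [Set.mem_inter_iff, Set.mem_preimage, Set.mem_singleton_iff, Prod.mk.injEq]
    tauto
  have := sum_negMulLog_submodular p fun i j k => measureReal_nonneg
  simp only [labelEntropy, Fintype.sum_prod_type, hfh, hgh, hk]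
  exact this

/-- The entropy of a partition is the limit of the entropies along an increasing sequence of finite
partitions that generates it. -/
lemma entropy_eq_iSup_labelEntropy (m : Measure Y) [IsProbabilityMeasure m] (ξ : Setoid Y)
    {L : ℕ → Type*} [∀ k, Fintype (L k)] [∀ k, MeasurableSpace (L k)]
    [∀ k, MeasurableSingletonClass (L k)] {f : ∀ k, Y → L k} (hf : ∀ k, Measurable (f k))
    (hmono : ∀ k x y, f (k + 1) x = f (k + 1) y → f k x = f k y)
    (hξ : ∀ x y, ξ x y ↔ ∀ k, f k x = f k y) :
    entropy m ξ = ⨆ k, ENNReal.ofReal (labelEntropy m (f k)) := by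
  have hcell : ∀ y, cell ξ (Quotient.mk ξ y) = ⋂ k, f k ⁻¹' {f k y} := by
    intro y
    ext x
    simp only [cell, Set.mem_ofPred_eq, Set.mem_iInter, Set.mem_preimage, Set.mem_singleton_iff]
    rw [← hξ]
    exact Quotient.eq
  have hmeas : ∀ k y, MeasurableSet (f k ⁻¹' {f k y}) := fun k y =>
    hf k (measurableSet_singleton _)
  have hanti : ∀ y, Antitone fun k => f k ⁻¹' {f k y} := fun y =>
    antitone_nat_of_succ_le fun k x hx => hmono k x y hx
  rw [entropy_eq_lintegral_surprisal m ξ]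
  · simp_rw [ofReal_labelEntropy m (hf _)]
    rw [← lintegral_iSup]
    · refine lintegral_congr fun y => ?_
      rw [hcell, (hanti y).measure_iInter (fun k => (hmeas k y).nullMeasurableSet)
        ⟨0, measure_ne_top _ _⟩,
        surprisal_antitone.map_iInf_of_continuousAt continuous_surprisal.continuousAt
          (by simp [surprisal])]
      rfl
    · intro k
      exact (measurable_of_finite fun i => surprisal (m (f k ⁻¹' {i}))).comp (hf k)
    · exact monotone_nat_of_le_succ fun k y =>
        surprisal_antitone (measure_mono (hanti y (Nat.le_succ k)))
  · intro q
    induction q using Quotient.inductionOn with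
    | h y => exact hcell y ▸ MeasurableSet.iInter fun k => hmeas k y

end LabelEntropy

/-! ### Shearer's inequality and the infimum rule -/

section Combinatorics

variable {G : Type*}

open scoped Classical in
/-- Shearer's inequality: if a family of finite sets covers every point of `F` at least `r` times,
then `r h(F)` is at most the sum of the values of `h` at the traces on `F`, for monotone submodular
`h` with `h(∅) = 0`. -/
lemma shearer {h : Finset G → ℝ} (h_empty : h ∅ = 0) (h_mono : Monotone h)
    (h_sub : ∀ a A B, A ⊆ B → h (insert a B) + h A ≤ h B + h (insert a A))
    {ι : Type*} (T : Finset ι) (K : ι → Finset G) (r : ℕ) (F : Finset G)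
    (hr : ∀ a ∈ F, r ≤ (T.filter fun t => a ∈ K t).card) :
    r * h F ≤ ∑ t ∈ T, h (K t ∩ F) := by
  induction F using Finset.induction_on with
  | empty => simp [h_empty]
  | insert a F _ ih =>
    have ih := ih fun b hb => hr b (Finset.mem_insert_of_mem hb)
    have ha := hr a (Finset.mem_insert_self a F)
    have hinc : 0 ≤ h (insert a F) - h F := sub_nonneg.2 (h_mono (Finset.subset_insert a F))
    have hterm : ∀ t ∈ T, h (K t ∩ F) + (if a ∈ K t then h (insert a F) - h F else 0) ≤
        h (K t ∩ insert a F) := by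
      intro t _
      split_ifs with hat
      · rw [Finset.inter_insert_of_mem hat]
        linarith [h_sub a (K t ∩ F) F Finset.inter_subset_right]
      · rw [Finset.inter_insert_of_notMem hat, add_zero]
    have hsum := Finset.sum_le_sum hterm
    rw [Finset.sum_add_distrib, ← Finset.sum_filter, Finset.sum_const, nsmul_eq_mul] at hsum
    have : (r : ℝ) * (h (insert a F) - h F) ≤
        ((T.filter fun t => a ∈ K t).card : ℝ) * (h (insert a F) - h F) :=
      mul_le_mul_of_nonneg_right (by exact_mod_cast ha) hinc
    linarith

variable [Group G]

open scoped Classical Pointwise in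
/-- Shearer's inequality for the cover of `F` by the right translates `K t`, `t ∈ K⁻¹F`, which
cover each point of `F` exactly `|K|` times. -/
lemma card_mul_le_card_inv_mul_mul {h : Finset G → ℝ} (h_empty : h ∅ = 0) (h_mono : Monotone h)
    (h_sub : ∀ a A B, A ⊆ B → h (insert a B) + h A ≤ h B + h (insert a A))
    (h_inv : ∀ (K : Finset G) (t : G), h (K.image (· * t)) = h K) (K F : Finset G) :
    (K.card : ℝ) * h F ≤ ((K⁻¹ * F).card : ℝ) * h K := by
  calc (K.card : ℝ) * h F ≤ ∑ t ∈ K⁻¹ * F, h (K.image (· * t) ∩ F) := by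
        refine shearer h_empty h_mono h_sub _ _ _ _ fun a ha => ?_
        refine Finset.card_le_card_of_injOn (fun k => k⁻¹ * a) (fun k hk => ?_) ?_
        · rw [Finset.mem_coe, Finset.mem_filter]
          exact ⟨Finset.mul_mem_mul (Finset.inv_mem_inv hk) ha,
            Finset.mem_image.2 ⟨k, hk, by group⟩⟩
        · intro k _ k' _ hkk'
          simpa using hkk'
    _ ≤ ∑ t ∈ K⁻¹ * F, h K := by
        refine Finset.sum_le_sum fun t _ => ?_
        rw [← h_inv K t]
        exact h_mono Finset.inter_subset_left
    _ = _ := by rw [Finset.sum_const, nsmul_eq_mul]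

open scoped Classical Pointwise in
lemma card_inv_mul_le (K F : Finset G) :
    (K⁻¹ * F).card ≤ F.card + ∑ k ∈ K, boundaryCard k⁻¹ F := by
  have hsub : K⁻¹ * F ⊆ F ∪ K.biUnion fun k => symmDiff (F.image fun s => k⁻¹ * s) F := by
    intro x hx
    obtain ⟨k, hk, s, hs, rfl⟩ := Finset.mem_mul.1 hx
    by_cases hxF : k * s ∈ F
    · exact Finset.mem_union_left _ hxF
    · refine Finset.mem_union_right _ (Finset.mem_biUnion.2 ⟨k⁻¹, Finset.mem_inv'.1 hk, ?_⟩)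
      rw [inv_inv]
      exact Finset.mem_symmDiff.2 (Or.inl ⟨Finset.mem_image_of_mem _ hs, hxF⟩)
  exact (Finset.card_le_card hsub).trans
    ((Finset.card_union_le _ _).trans (Nat.add_le_add_left Finset.card_biUnion_le _))

lemma eventually_moreInvariant {p : Finset G → Prop} (K : Finset G) {δ : ℝ} (hδ : 0 < δ)
    (h : ∀ F, IsInvariantUpTo K δ F → p F) : ∀ᶠ F in moreInvariant G, p F :=
  ⟨K, δ, hδ, h⟩

open scoped Classical Pointwise in
lemma eventually_card_inv_mul_le (K : Finset G) {ε : ℝ} (hε : 0 < ε) :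
    ∀ᶠ F in moreInvariant G, ((K⁻¹ * F).card : ℝ) ≤ (1 + ε) * F.card := by
  have hδ : 0 < ε / (K.card + 1) := by positivity
  refine eventually_moreInvariant K⁻¹ hδ fun F hF => ?_
  have h1 : ((K⁻¹ * F).card : ℝ) ≤ F.card + ∑ k ∈ K, (boundaryCard k⁻¹ F : ℝ) := by
    exact_mod_cast card_inv_mul_le K F
  have h2 : ∑ k ∈ K, (boundaryCard k⁻¹ F : ℝ) ≤ K.card • (ε / (K.card + 1) * F.card) :=
    Finset.sum_le_card_nsmul _ _ _ fun k hk => hF.2 _ (Finset.inv_mem_inv hk)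
  have h3 : (K.card : ℝ) * (ε / (K.card + 1)) ≤ ε := by
    rw [mul_div_assoc', div_le_iff₀ (by positivity)]
    nlinarith
  rw [nsmul_eq_mul, ← mul_assoc] at h2
  have h4 := mul_le_mul_of_nonneg_right h3 (Nat.cast_nonneg (α := ℝ) F.card)
  linarith

lemma moreInvariant_neBot (hG : IsAmenable G) : (moreInvariant G).NeBot := by
  refine ⟨fun hbot => ?_⟩
  obtain ⟨F, hF, hlim⟩ := hG
  obtain ⟨K, δ, hδ, h⟩ : ∅ ∈ moreInvariant G := hbot ▸ mem_bot
  have hev : ∀ᶠ n in atTop, ∀ g ∈ K, (boundaryCard g (F n) : ℝ) / ((F n).card : ℝ) < δ :=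
    (Filter.eventually_all_finset K).2 fun g _ => (hlim g).eventually_lt_const hδ
  obtain ⟨n, hn⟩ := hev.exists
  have hpos : (0 : ℝ) < (F n).card := by exact_mod_cast (hF n).card_pos
  exact h (F n) ⟨hF n, fun g hg => ((div_lt_iff₀ hpos).1 (hn g hg)).le⟩

open scoped Classical Pointwise in
/-- The infimum rule: a set function obeying Shearer's inequality for translates has averages that
converge to their infimum as `F` becomes more and more invariant. -/
lemma tendsto_average_iInf {h : Finset G → ℝ≥0∞}
    (h_shearer : ∀ K F : Finset G, (K.card : ℝ≥0∞) * h F ≤ ((K⁻¹ * F).card : ℝ≥0∞) * h K) :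
    Tendsto (fun F => h F / (F.card : ℝ≥0∞)) (moreInvariant G)
      (𝓝 (⨅ (F : Finset G) (_ : F.Nonempty), h F / (F.card : ℝ≥0∞))) := by
  have h_ne : ∀ᶠ F in moreInvariant G, F.Nonempty :=
    eventually_moreInvariant ∅ one_pos fun F hF => hF.1
  refine tendsto_order.2 ⟨fun a ha => ?_, fun b hb => ?_⟩
  · filter_upwards [h_ne] with F hF
    exact ha.trans_le (iInf₂_le F hF)
  · obtain ⟨K, hK⟩ := iInf_lt_iff.1 hb
    obtain ⟨hK0, hKb⟩ := iInf_lt_iff.1 hK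
    have hfin : h K / (K.card : ℝ≥0∞) ≠ ∞ := hKb.ne_top
    -- choose `ε` with `(1 + ε) h(K) / |K| < b`
    have hcont : Tendsto (fun ε : ℝ => ENNReal.ofReal (1 + ε) * (h K / (K.card : ℝ≥0∞)))
        (𝓝[>] 0) (𝓝 (ENNReal.ofReal (1 + 0) * (h K / (K.card : ℝ≥0∞)))) := by
      refine ENNReal.Tendsto.mul_const ?_ (Or.inr hfin)
      exact ENNReal.tendsto_ofReal
        ((tendsto_const_nhds.add tendsto_id).mono_left nhdsWithin_le_nhds)
    have hlt : ENNReal.ofReal (1 + 0) * (h K / (K.card : ℝ≥0∞)) < b := by simpa using hKb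
    obtain ⟨ε, hεb, hε⟩ := ((hcont.eventually_lt_const hlt).and self_mem_nhdsWithin).exists
    filter_upwards [h_ne, eventually_card_inv_mul_le K hε] with F hF hKF
    refine lt_of_le_of_lt ?_ hεb
    have hKc : (K.card : ℝ≥0∞) ≠ 0 := by exact_mod_cast hK0.card_pos.ne'
    have hFc : (F.card : ℝ≥0∞) ≠ 0 := by exact_mod_cast hF.card_pos.ne'
    have hKF' : ((K⁻¹ * F).card : ℝ≥0∞) ≤ ENNReal.ofReal (1 + ε) * F.card := by
      have h1 := ENNReal.ofReal_le_ofReal hKF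
      rwa [ENNReal.ofReal_mul (by linarith [show (0 : ℝ) < ε from hε]), ENNReal.ofReal_natCast,
        ENNReal.ofReal_natCast] at h1
    rw [ENNReal.div_le_iff hFc (ENNReal.natCast_ne_top _)]
    calc h F ≤ ((K⁻¹ * F).card : ℝ≥0∞) * h K / K.card := by
          rw [ENNReal.le_div_iff_mul_le (Or.inl hKc) (Or.inl (ENNReal.natCast_ne_top _)), mul_comm]
          exact h_shearer K F
      _ = ((K⁻¹ * F).card : ℝ≥0∞) * (h K / K.card) := mul_div_assoc _ _ _
      _ ≤ (ENNReal.ofReal (1 + ε) * F.card) * (h K / K.card) := by gcongr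
      _ = _ := by ring

end Combinatorics

/-! ### Conditional probabilities of a canonical system -/

section CanonicalSystems

variable {X : Type*} {𝒜 : MeasurableSpace X} [mX : MeasurableSpace X] {μ : Measure X}
  {C : Setoid X} {S : MeasureSystem C}

/-- The conditional probability of `E` at `x`: the mass of `E` for the conditional measure on the
element of `C` through `x`. -/
noncomputable def condMass (S : MeasureSystem C) (E : Set X) (x : X) : ℝ≥0∞ :=
  S.meas (Quotient.mk C x) ((Subtype.val : cell C (Quotient.mk C x) → X) ⁻¹' E)

lemma measurable_quotientMk (C : Setoid X) : Measurable (Quotient.mk C) :=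
  measurable_quotient_mk''

lemma lintegral_factorMeasure {φ : Quotient C → ℝ≥0∞}
    (hφ : AEMeasurable φ (factorMeasure μ C)) :
    ∫⁻ c, φ c ∂factorMeasure μ C = ∫⁻ x, φ (Quotient.mk C x) ∂μ :=
  lintegral_map' hφ (measurable_quotientMk C).aemeasurable

lemma IsCanonicalSystem.ae_isProbabilityMeasure (hS : IsCanonicalSystem μ C S) :
    ∀ᵐ c ∂factorMeasure μ C, IsProbabilityMeasure (S.meas c) :=
  hS.lebesgue.mono fun _ hc => hc.1

lemma IsCanonicalSystem.setLIntegral_condMass_of_isSaturated (hS : IsCanonicalSystem μ C S)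
    {E B : Set X} (hE : MeasurableSet E) (hB : MeasurableSet B) (hBC : IsSaturated C B) :
    ∫⁻ x in B, condMass S E x ∂μ = μ (E ∩ B) := by
  rw [hS.disintegration _ (hE.inter hB), lintegral_factorMeasure (hS.aemeasurable _ (hE.inter hB)),
    ← lintegral_indicator hB]
  refine lintegral_congr fun x => ?_
  -- an element of `C` is contained in the `C`-set `B` or disjoint from it
  have hrel : ∀ y : cell C (Quotient.mk C x), C x y := fun y => C.symm (Quotient.exact y.2)
  by_cases hx : x ∈ B
  · rw [Set.indicator_of_mem hx, condMass]
    congr 1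
    ext y
    have : (y : X) ∈ B := hBC x y (hrel y) hx
    simp [this]
  · rw [Set.indicator_of_notMem hx, ← measure_empty (μ := S.meas (Quotient.mk C x))]
    congr 1
    ext y
    have : (y : X) ∉ B := fun hy => hx (hBC y x (C.symm (hrel y)) hy)
    simp [this]

/-- The σ-algebra of the measurable sets that agree mod `μ` with a set of `𝒜`. It contains the
measurable `C`-sets when `C` corresponds to `𝒜`, and, unlike the σ-algebra of `C`-sets, it is
invariant under every measure-preserving transformation under which `𝒜` is invariant. -/
@[reducible]
def saturation (𝒜 : MeasurableSpace X) {mX : MeasurableSpace X} (μ : Measure X) :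
    MeasurableSpace X :=
  eventuallyMeasurableSpace 𝒜 (ae μ) ⊓ mX

lemma measurableSet_saturation {D : Set X} :
    MeasurableSet[saturation 𝒜 μ] D ↔
      (∃ A, MeasurableSet[𝒜] A ∧ D =ᵐ[μ] A) ∧ MeasurableSet[mX] D :=
  MeasurableSpace.measurableSet_inf

lemma saturation_le : saturation 𝒜 μ ≤ mX := inf_le_right

lemma IsCanonicalSystem.setLIntegral_condMass (hS : IsCanonicalSystem μ C S)
    (h𝒜C : Corresponds 𝒜 μ C) {E D : Set X} (hE : MeasurableSet E)
    (hD : MeasurableSet[saturation 𝒜 μ] D) :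
    ∫⁻ x in D, condMass S E x ∂μ = μ (E ∩ D) := by
  obtain ⟨⟨A, hA, hDA⟩, -⟩ := measurableSet_saturation.1 hD
  obtain ⟨B, hB, hBC, hAB⟩ := h𝒜C.1 A hA
  have hDB := hDA.trans hAB
  rw [setLIntegral_congr hDB, hS.setLIntegral_condMass_of_isSaturated hE hB hBC]
  exact measure_congr ((ae_eq_refl E).inter hDB.symm)

lemma measurable_saturation_quotientMk (h𝒜C : Corresponds 𝒜 μ C) :
    @Measurable X (Quotient C) (saturation 𝒜 μ) _ (Quotient.mk C) := by
  intro U hU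
  have hm := measurable_quotientMk C hU
  refine measurableSet_saturation.2 ⟨h𝒜C.2 _ hm fun x y hxy hx => ?_, hm⟩
  have : Quotient.mk C x = Quotient.mk C y := Quotient.sound hxy
  rwa [Set.mem_preimage, ← this]

lemma IsCanonicalSystem.exists_condMass_ae_eq (hS : IsCanonicalSystem μ C S)
    (h𝒜C : Corresponds 𝒜 μ C) {E : Set X} (hE : MeasurableSet E) :
    ∃ ψ : X → ℝ≥0∞, Measurable[saturation 𝒜 μ] ψ ∧ condMass S E =ᵐ[μ] ψ := by
  obtain ⟨ψ, hψ, hae⟩ := hS.aemeasurable E hE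
  exact ⟨fun x => ψ (Quotient.mk C x), hψ.comp (measurable_saturation_quotientMk h𝒜C),
    ae_of_ae_map (measurable_quotientMk C).aemeasurable hae⟩

/-- Functions measurable for a sub-σ-algebra are determined a.e. by their integrals over its
sets. -/
lemma ae_eq_of_forall_setLIntegral_eq_of_le [IsFiniteMeasure μ] {𝒟 : MeasurableSpace X}
    (h𝒟 : 𝒟 ≤ mX) {φ ψ : X → ℝ≥0∞} (hφ : Measurable[𝒟] φ) (hψ : Measurable[𝒟] ψ)
    (h : ∀ D, MeasurableSet[𝒟] D → ∫⁻ x in D, φ x ∂μ = ∫⁻ x in D, ψ x ∂μ) : φ =ᵐ[μ] ψ := by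
  refine ae_eq_of_ae_eq_trim (hm := h𝒟) ?_
  refine ae_eq_of_forall_setLIntegral_eq_of_sigmaFinite hφ hψ fun D hD _ => ?_
  rw [restrict_trim h𝒟 μ hD, lintegral_trim h𝒟 hφ, lintegral_trim h𝒟 hψ]
  exact h D hD

/-- Conditional probabilities are equivariant under automorphisms preserving `𝒜`. -/
lemma IsCanonicalSystem.condMass_preimage_ae_eq [IsFiniteMeasure μ] (hS : IsCanonicalSystem μ C S)
    (h𝒜C : Corresponds 𝒜 μ C) {T : X → X} (hT : MeasurePreserving T μ μ)
    (hTe : MeasurableEmbedding T) (hT𝒜 : ∀ A, MeasurableSet[𝒜] A → MeasurableSet[𝒜] (T ⁻¹' A))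
    (hT𝒜' : ∀ A, MeasurableSet[𝒜] A → ∃ A', MeasurableSet[𝒜] A' ∧ T ⁻¹' A' = A)
    {E : Set X} (hE : MeasurableSet E) :
    condMass S (T ⁻¹' E) =ᵐ[μ] condMass S E ∘ T := by
  have hTsat : @Measurable X X (saturation 𝒜 μ) (saturation 𝒜 μ) T := by
    intro D hD
    obtain ⟨⟨A, hA, hDA⟩, hDm⟩ := measurableSet_saturation.1 hD
    exact measurableSet_saturation.2
      ⟨⟨T ⁻¹' A, hT𝒜 A hA, hT.quasiMeasurePreserving.preimage_ae_eq hDA⟩, hT.measurable hDm⟩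
  obtain ⟨φ, hφ, hφE⟩ := hS.exists_condMass_ae_eq h𝒜C (hT.measurable hE)
  obtain ⟨ψ, hψ, hψE⟩ := hS.exists_condMass_ae_eq h𝒜C hE
  have hψT : condMass S E ∘ T =ᵐ[μ] ψ ∘ T := hT.quasiMeasurePreserving.ae_eq_comp hψE
  refine hφE.trans (EventuallyEq.trans ?_ hψT.symm)
  refine ae_eq_of_forall_setLIntegral_eq_of_le saturation_le hφ (hψ.comp hTsat) fun D hD => ?_
  obtain ⟨⟨A, hA, hDA⟩, -⟩ := measurableSet_saturation.1 hD
  obtain ⟨A', hA', rfl⟩ := hT𝒜' A hA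
  obtain ⟨B, hB, hBC, hAB⟩ := h𝒜C.1 A' hA'
  have hDB : D =ᵐ[μ] T ⁻¹' B := hDA.trans (hT.quasiMeasurePreserving.preimage_ae_eq hAB)
  calc ∫⁻ x in D, φ x ∂μ = ∫⁻ x in D, condMass S (T ⁻¹' E) x ∂μ :=
        lintegral_congr_ae (ae_restrict_of_ae hφE.symm)
    _ = μ (T ⁻¹' E ∩ D) := hS.setLIntegral_condMass h𝒜C (hT.measurable hE) hD
    _ = μ (T ⁻¹' (E ∩ B)) := measure_congr ((ae_eq_refl _).inter hDB)
    _ = ∫⁻ x in B, condMass S E x ∂μ := by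
        rw [hT.measure_preimage_emb hTe, hS.setLIntegral_condMass_of_isSaturated hE hB hBC]
    _ = ∫⁻ x in T ⁻¹' B, condMass S E (T x) ∂μ :=
        (hT.setLIntegral_comp_preimage_emb hTe _ _).symm
    _ = ∫⁻ x in D, condMass S E (T x) ∂μ := (setLIntegral_congr hDB).symm
    _ = ∫⁻ x in D, (ψ ∘ T) x ∂μ := lintegral_congr_ae (ae_restrict_of_ae hψT)

end CanonicalSystems

/-! ### Mean conditional entropy of finite partitions -/

section FactorEntropy

variable {X : Type*} {𝒜 : MeasurableSpace X} [mX : MeasurableSpace X] {μ : Measure X}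
  {C : Setoid X} {S : MeasureSystem C} {ι κ τ : Type*}
  [Fintype ι] [Fintype κ] [Fintype τ]

/-- The mean conditional entropy of the finite partition into the fibres of a labelling `f`. -/
noncomputable def meanLabelEntropy {ι : Type*} [Fintype ι] (μ : Measure X) (S : MeasureSystem C)
    (f : X → ι) : ℝ≥0∞ :=
  ∫⁻ c, ENNReal.ofReal (labelEntropy (S.meas c) fun y => f y) ∂factorMeasure μ C

lemma isProbabilityMeasure_factorMeasure [IsProbabilityMeasure μ] :
    IsProbabilityMeasure (factorMeasure μ C) :=
  Measure.isProbabilityMeasure_map (measurable_quotientMk C).aemeasurable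

lemma IsCanonicalSystem.meanLabelEntropy_ne_top [IsProbabilityMeasure μ]
    (hS : IsCanonicalSystem μ C S) (f : X → ι) : meanLabelEntropy μ S f ≠ ∞ := by
  have := isProbabilityMeasure_factorMeasure (μ := μ) (C := C)
  refine ne_top_of_le_ne_top (ENNReal.ofReal_ne_top (r := Fintype.card ι)) ?_
  calc meanLabelEntropy μ S f ≤ ∫⁻ _, ENNReal.ofReal (Fintype.card ι) ∂factorMeasure μ C := by
        refine lintegral_mono_ae ?_
        filter_upwards [hS.ae_isProbabilityMeasure] with c hc
        refine ENNReal.ofReal_le_ofReal ?_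
        calc labelEntropy (S.meas c) (fun y => f y) ≤ ∑ _ : ι, (1 : ℝ) :=
              Finset.sum_le_sum fun i _ => (Real.negMulLog_le_one_sub_self measureReal_nonneg).trans
                (sub_le_self _ measureReal_nonneg)
          _ = Fintype.card ι := by simp
    _ = ENNReal.ofReal (Fintype.card ι) := by simp

variable [MeasurableSpace ι] [MeasurableSingletonClass ι] [MeasurableSpace κ]
  [MeasurableSingletonClass κ] [MeasurableSpace τ] [MeasurableSingletonClass τ]

lemma IsCanonicalSystem.ae_measurable_restrict (hS : IsCanonicalSystem μ C S) {f : X → ι}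
    (hf : Measurable f) :
    ∀ᵐ c ∂factorMeasure μ C, Measurable[S.σ c] fun y : cell C c => f y := by
  have h : ∀ᵐ c ∂factorMeasure μ C, ∀ i : ι,
      MeasurableSet[S.σ c] ((Subtype.val : cell C c → X) ⁻¹' (f ⁻¹' {i})) :=
    ae_all_iff.2 fun i => hS.measurable_trace _ (hf (measurableSet_singleton i))
  filter_upwards [h] with c hc
  let _ := S.σ c
  exact measurable_to_countable' hc

lemma IsCanonicalSystem.aemeasurable_labelEntropy (hS : IsCanonicalSystem μ C S) {f : X → ι}
    (hf : Measurable f) :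
    AEMeasurable (fun c => ENNReal.ofReal (labelEntropy (S.meas c) fun y => f y))
      (factorMeasure μ C) := by
  refine (Finset.aemeasurable_fun_sum _ fun i _ => ?_).ennreal_ofReal
  exact Real.continuous_negMulLog.measurable.comp_aemeasurable
    (hS.aemeasurable _ (hf (measurableSet_singleton i))).ennreal_toReal

lemma IsCanonicalSystem.meanLabelEntropy_mono (hS : IsCanonicalSystem μ C S) {f : X → ι}
    {f' : X → κ} (hf : Measurable f) (hf' : Measurable f') (h : ∀ x y, f' x = f' y → f x = f y) :
    meanLabelEntropy μ S f ≤ meanLabelEntropy μ S f' := by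
  refine lintegral_mono_ae ?_
  filter_upwards [hS.ae_isProbabilityMeasure, hS.ae_measurable_restrict hf,
    hS.ae_measurable_restrict hf'] with c hc h1 h2
  exact ENNReal.ofReal_le_ofReal (labelEntropy_mono _ h1 h2 fun x y => h x y)

lemma IsCanonicalSystem.meanLabelEntropy_congr (hS : IsCanonicalSystem μ C S) {f : X → ι}
    {f' : X → κ} (hf : Measurable f) (hf' : Measurable f') (h : ∀ x y, f x = f y ↔ f' x = f' y) :
    meanLabelEntropy μ S f = meanLabelEntropy μ S f' :=
  le_antisymm (hS.meanLabelEntropy_mono hf hf' fun x y => (h x y).2)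
    (hS.meanLabelEntropy_mono hf' hf fun x y => (h x y).1)

lemma IsCanonicalSystem.meanLabelEntropy_submodular (hS : IsCanonicalSystem μ C S) {f : X → ι}
    {g : X → κ} {h : X → τ} (hf : Measurable f) (hg : Measurable g) (hh : Measurable h) :
    meanLabelEntropy μ S (fun y => (f y, g y, h y)) + meanLabelEntropy μ S h ≤
      meanLabelEntropy μ S (fun y => (f y, h y)) + meanLabelEntropy μ S (fun y => (g y, h y)) := by
  rw [meanLabelEntropy, meanLabelEntropy, meanLabelEntropy, meanLabelEntropy,
    ← lintegral_add_left' (hS.aemeasurable_labelEntropy (hf.prodMk (hg.prodMk hh))),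
    ← lintegral_add_left' (hS.aemeasurable_labelEntropy (hf.prodMk hh))]
  refine lintegral_mono_ae ?_
  filter_upwards [hS.ae_isProbabilityMeasure, hS.ae_measurable_restrict hf,
    hS.ae_measurable_restrict hg] with c hc h1 h2
  rw [← ENNReal.ofReal_add (labelEntropy_nonneg _ _) (labelEntropy_nonneg _ _),
    ← ENNReal.ofReal_add (labelEntropy_nonneg _ _) (labelEntropy_nonneg _ _)]
  exact ENNReal.ofReal_le_ofReal (labelEntropy_submodular _ (fun y : cell C c => h y) h1 h2)

lemma IsCanonicalSystem.meanLabelEntropy_eq_lintegral_condMass (hS : IsCanonicalSystem μ C S)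
    {f : X → ι} (hf : Measurable f) :
    meanLabelEntropy μ S f =
      ∫⁻ x, ENNReal.ofReal (∑ i, Real.negMulLog (condMass S (f ⁻¹' {i}) x).toReal) ∂μ :=
  lintegral_factorMeasure (hS.aemeasurable_labelEntropy hf)

/-- The mean conditional entropy is invariant under automorphisms preserving `𝒜`. -/
lemma IsCanonicalSystem.meanLabelEntropy_comp [IsFiniteMeasure μ] (hS : IsCanonicalSystem μ C S)
    (h𝒜C : Corresponds 𝒜 μ C) {T : X → X} (hT : MeasurePreserving T μ μ)
    (hTe : MeasurableEmbedding T) (hT𝒜 : ∀ A, MeasurableSet[𝒜] A → MeasurableSet[𝒜] (T ⁻¹' A))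
    (hT𝒜' : ∀ A, MeasurableSet[𝒜] A → ∃ A', MeasurableSet[𝒜] A' ∧ T ⁻¹' A' = A)
    {f : X → ι} (hf : Measurable f) :
    meanLabelEntropy μ S (f ∘ T) = meanLabelEntropy μ S f := by
  rw [hS.meanLabelEntropy_eq_lintegral_condMass hf,
    hS.meanLabelEntropy_eq_lintegral_condMass (hf.comp hT.measurable),
    ← hT.lintegral_comp_emb hTe
      fun x => ENNReal.ofReal (∑ i, Real.negMulLog (condMass S (f ⁻¹' {i}) x).toReal)]
  have h : ∀ᵐ x ∂μ, ∀ i, condMass S (T ⁻¹' (f ⁻¹' {i})) x = condMass S (f ⁻¹' {i}) (T x) :=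
    ae_all_iff.2 fun i =>
      hS.condMass_preimage_ae_eq h𝒜C hT hTe hT𝒜 hT𝒜' (hf (measurableSet_singleton i))
  refine lintegral_congr_ae ?_
  filter_upwards [h] with x hx
  simp only [Set.preimage_comp, hx]

end FactorEntropy

/-! ### Entropy of joins along the action -/

section JoinLabels

variable {G X : Type*} [Group G] [MulAction G X]

lemma joinOver_rel {α : Setoid X} {F : Finset G} {x y : X} :
    joinOver α F x y ↔ ∀ g ∈ F, α (g • x) (g • y) := by
  unfold joinOver
  rw [iInf, Setoid.sInf_iff, Set.forall_mem_range]
  refine forall_congr' fun g => ?_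
  rw [iInf, Setoid.sInf_iff, Set.forall_mem_range]
  rfl

lemma joinOver_singleton_one (α : Setoid X) : joinOver α ({1} : Finset G) = α :=
  Setoid.ext fun x y => by simp [joinOver_rel]

/-- The labelling whose fibres form `(α_k)^F`, for the finite partition `α_k` generated by
`B 0, …, B (k - 1)`. -/
def joinLabel (B : ℕ → Set X) (k : ℕ) (F : Finset G) (x : X) : F → Fin k → Prop :=
  fun g n => (g : G) • x ∈ B n

lemma joinLabel_eq_iff {B : ℕ → Set X} {k : ℕ} {F : Finset G} {x y : X} :
    joinLabel B k F x = joinLabel B k F y ↔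
      ∀ g ∈ F, ∀ n < k, g • x ∈ B n ↔ g • y ∈ B n := by
  simp only [funext_iff, joinLabel, eq_iff_iff, Subtype.forall, Fin.forall_iff]

variable {𝒜 : MeasurableSpace X} [mX : MeasurableSpace X] {μ : Measure X} {C : Setoid X}
  {S : MeasureSystem C}

lemma measurable_joinLabel {B : ℕ → Set X} (hB : ∀ n, MeasurableSet (B n))
    (hT : ∀ g : G, Measurable fun x : X => g • x) (k : ℕ) (F : Finset G) :
    Measurable (joinLabel B k F) :=
  measurable_pi_lambda _ fun g => measurable_pi_lambda _ fun n =>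
    measurableSet_setOfPred.1 (hT g (hB n))

open scoped Classical in
/-- The mean conditional entropy of the joins of a measurable partition is the supremum of those of
its finite subpartitions. -/
lemma IsCanonicalSystem.condEntropy_joinOver (hS : IsCanonicalSystem μ C (canonicalSystem μ C))
    {B : ℕ → Set X} (hB : ∀ n, MeasurableSet (B n)) (hT : ∀ g : G, Measurable fun x : X => g • x)
    {α : Setoid X} (hα : ∀ x y, α x y ↔ ∀ n, x ∈ B n ↔ y ∈ B n) (F : Finset G) :
    condEntropy μ (joinOver α F) C =
      ⨆ k, meanLabelEntropy μ (canonicalSystem μ C) (joinLabel B k F) := by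
  have hmeas := measurable_joinLabel hB hT
  have hmono : ∀ k x y, joinLabel B (k + 1) F x = joinLabel B (k + 1) F y →
      joinLabel B k F x = joinLabel B k F y := fun k x y h =>
    joinLabel_eq_iff.2 fun g hg n hn => joinLabel_eq_iff.1 h g hg n (hn.trans k.lt_succ_self)
  have hrestrict : ∀ᵐ c ∂factorMeasure μ C, ∀ k,
      Measurable[(canonicalSystem μ C).σ c] fun y : cell C c => joinLabel B k F y :=
    ae_all_iff.2 fun k => hS.ae_measurable_restrict (hmeas k F)
  unfold meanLabelEntropy
  rw [condEntropy, ← lintegral_iSup']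
  · refine lintegral_congr_ae ?_
    filter_upwards [hS.ae_isProbabilityMeasure, hrestrict] with c hc hm
    refine entropy_eq_iSup_labelEntropy _ _ hm (fun k x y => hmono k x y) fun x y => ?_
    rw [Setoid.comap_rel, joinOver_rel]
    simp only [hα, joinLabel_eq_iff]
    exact ⟨fun h k g hg n _ => h g hg n, fun h g hg n => h (n + 1) g hg n n.lt_succ_self⟩
  · exact fun k => hS.aemeasurable_labelEntropy (hmeas k F)
  · filter_upwards [hS.ae_isProbabilityMeasure, hrestrict] with c hc hm
    exact monotone_nat_of_le_succ fun k => ENNReal.ofReal_le_ofReal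
      (labelEntropy_mono _ (hm k) (hm (k + 1)) fun x y => hmono k x y)

open scoped Classical Pointwise in
/-- Shearer's inequality for the mean conditional entropies of the joins of a finite partition. -/
lemma IsCanonicalSystem.card_mul_meanLabelEntropy_le [IsProbabilityMeasure μ]
    (hS : IsCanonicalSystem μ C S) (h𝒜C : Corresponds 𝒜 μ C)
    (hT : ∀ g : G, MeasurePreserving (fun x : X => g • x) μ μ)
    (hinv : ∀ (g : G) (A : Set X), MeasurableSet[𝒜] A →
      MeasurableSet[𝒜] ((fun x : X => g • x) '' A))
    {B : ℕ → Set X} (hB : ∀ n, MeasurableSet (B n)) (k : ℕ) (K F : Finset G) :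
    (K.card : ℝ≥0∞) * meanLabelEntropy μ S (joinLabel B k F) ≤
      ((K⁻¹ * F).card : ℝ≥0∞) * meanLabelEntropy μ S (joinLabel B k K) := by
  have hmeas := measurable_joinLabel hB (fun g : G => (hT g).measurable) k
  set H : Finset G → ℝ≥0∞ := fun F => meanLabelEntropy μ S (joinLabel B k F)
  have hfin : ∀ F, H F ≠ ∞ := fun F => hS.meanLabelEntropy_ne_top _
  have hmono : Monotone H := fun F F' h => hS.meanLabelEntropy_mono (hmeas F) (hmeas F')
    fun x y hxy => joinLabel_eq_iff.2 fun g hg => joinLabel_eq_iff.1 hxy g (h hg)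
  have hempty : H ∅ = 0 := by
    have : H ∅ = ∫⁻ _, 0 ∂factorMeasure μ C := by
      refine lintegral_congr_ae ?_
      filter_upwards [hS.ae_isProbabilityMeasure] with c hc
      have huniv : ∀ i : (∅ : Finset G) → Fin k → Prop,
          (fun y : cell C c => joinLabel B k (∅ : Finset G) (y : X)) ⁻¹' {i} = Set.univ := fun i =>
        Set.eq_univ_of_forall fun y => Subsingleton.elim _ _
      simp [labelEntropy, huniv]
    rw [this, lintegral_zero]
  have hsub : ∀ a A D, A ⊆ D → H (insert a D) + H A ≤ H D + H (insert a A) := by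
    intro a A D hAD
    have h1 : H (insert a D) = meanLabelEntropy μ S
        fun x => (joinLabel B k {a} x, joinLabel B k D x, joinLabel B k A x) := by
      refine hS.meanLabelEntropy_congr (hmeas _)
        ((hmeas _).prodMk ((hmeas _).prodMk (hmeas _))) fun x y => ?_
      simp only [Prod.mk.injEq, joinLabel_eq_iff, Finset.forall_mem_insert, Finset.mem_singleton,
        forall_eq]
      exact ⟨fun h => ⟨h.1, h.2, fun g hg => h.2 g (hAD hg)⟩, fun h => ⟨h.1, h.2.1⟩⟩
    have h2 : H (insert a A) = meanLabelEntropy μ S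
        fun x => (joinLabel B k {a} x, joinLabel B k A x) := by
      refine hS.meanLabelEntropy_congr (hmeas _) ((hmeas _).prodMk (hmeas _)) fun x y => ?_
      simp only [Prod.mk.injEq, joinLabel_eq_iff, Finset.forall_mem_insert, Finset.mem_singleton,
        forall_eq]
    have h3 : H D = meanLabelEntropy μ S fun x => (joinLabel B k D x, joinLabel B k A x) := by
      refine hS.meanLabelEntropy_congr (hmeas _) ((hmeas _).prodMk (hmeas _)) fun x y => ?_
      simp only [Prod.mk.injEq, joinLabel_eq_iff]
      exact ⟨fun h => ⟨h, fun g hg => h g (hAD hg)⟩, fun h => h.1⟩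
    rw [h1, h2, h3, add_comm (meanLabelEntropy μ S fun x => (joinLabel B k D x, _))]
    exact hS.meanLabelEntropy_submodular (hmeas _) (hmeas _) (hmeas _)
  have hpre : ∀ (t : G) (A : Set X),
      (fun x : X => t • x) ⁻¹' A = (fun x : X => t⁻¹ • x) '' A := fun t A => by
    rw [Set.image_smul, ← Set.preimage_smul]
  have hemb : ∀ t : G, MeasurableEmbedding fun x : X => t • x := fun t =>
    MeasurableEquiv.measurableEmbedding
      { toEquiv := MulAction.toPerm t
        measurable_toFun := (hT t).measurable
        measurable_invFun := (hT t⁻¹).measurable }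
  have hHinv : ∀ (K : Finset G) (t : G), H (K.image (· * t)) = H K := by
    intro K t
    change meanLabelEntropy μ S (joinLabel B k (K.image (· * t))) =
      meanLabelEntropy μ S (joinLabel B k K)
    rw [← hS.meanLabelEntropy_comp h𝒜C (hT t) (hemb t) (fun A hA => ?_) (fun A hA => ?_)
      (hmeas K)]
    · refine hS.meanLabelEntropy_congr (hmeas _) ((hmeas K).comp (hT t).measurable) fun x y => ?_
      simp only [Function.comp_apply, joinLabel_eq_iff, Finset.forall_mem_image, mul_smul]
    · rw [hpre]
      exact hinv _ A hA
    · exact ⟨_, hinv t A hA, Set.preimage_image_eq _ (MulAction.injective t)⟩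
  have hreal := card_mul_le_card_inv_mul_mul (h := fun F => (H F).toReal) (by simp [hempty])
    (fun F F' h => ENNReal.toReal_mono (hfin F') (hmono h))
    (fun a A D h => by
      rw [← ENNReal.toReal_add (hfin _) (hfin _), ← ENNReal.toReal_add (hfin _) (hfin _)]
      exact ENNReal.toReal_mono (ENNReal.add_ne_top.2 ⟨hfin _, hfin _⟩) (hsub a A D h))
    (fun K t => by rw [hHinv]) K F
  rw [← ENNReal.toReal_le_toReal (ENNReal.mul_ne_top (ENNReal.natCast_ne_top _) (hfin F))
    (ENNReal.mul_ne_top (ENNReal.natCast_ne_top _) (hfin K)), ENNReal.toReal_mul,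
    ENNReal.toReal_mul, ENNReal.toReal_natCast, ENNReal.toReal_natCast]
  exact hreal

open scoped Classical Pointwise in
/-- Shearer's inequality for the mean conditional entropies of the joins of a measurable
partition. -/
lemma card_mul_condEntropy_joinOver_le [IsProbabilityMeasure μ] (h𝒜C : Corresponds 𝒜 μ C)
    (hT : ∀ g : G, MeasurePreserving (fun x : X => g • x) μ μ)
    (hinv : ∀ (g : G) (A : Set X), MeasurableSet[𝒜] A →
      MeasurableSet[𝒜] ((fun x : X => g • x) '' A))
    {α : Setoid X} (hα : IsMeasurablePartition α) (K F : Finset G) :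
    (K.card : ℝ≥0∞) * condEntropy μ (joinOver α F) C ≤
      ((K⁻¹ * F).card : ℝ≥0∞) * condEntropy μ (joinOver α K) C := by
  by_cases hex : ∃ S, IsCanonicalSystem μ C S
  · have hS : IsCanonicalSystem μ C (canonicalSystem μ C) := by
      rw [canonicalSystem, dif_pos hex]
      exact hex.choose_spec
    obtain ⟨B, hB, hsep⟩ := hα
    have hrel : ∀ x y, α x y ↔ ∀ n, x ∈ B n ↔ y ∈ B n := by
      refine fun x y => ⟨fun h n => ⟨(hB n).2 x y h, (hB n).2 y x (α.symm h)⟩, fun h => ?_⟩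
      by_contra hxy
      obtain ⟨n, hn⟩ := hsep x y hxy
      have := h n
      tauto
    have hjoin := hS.condEntropy_joinOver (fun n => (hB n).1) (fun g => (hT g).measurable) hrel
    rw [hjoin F, hjoin K, ENNReal.mul_iSup, ENNReal.mul_iSup]
    exact iSup_mono fun k =>
      hS.card_mul_meanLabelEntropy_le h𝒜C hT hinv (fun n => (hB n).1) k K F
  · -- without a canonical system the conditional measures are zero by convention
    have hzero : ∀ β : Setoid X, condEntropy μ β C = 0 := by
      intro β
      rw [condEntropy, canonicalSystem, dif_neg hex]
      simp [entropy]
    simp [hzero]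

end JoinLabels

end AmenableEntropy

open AmenableEntropy in
theorem theorem3 {G X : Type*} [Group G] [Countable G] (hG : IsAmenable G)
    (𝒜 : MeasurableSpace X) [mX : MeasurableSpace X] (μ : Measure X) (hμ : IsLebesgueSpace μ)
    [MulAction G X] (hT : ∀ g : G, MeasurePreserving (fun x : X => g • x) μ μ)
    (h𝒜 : 𝒜 ≤ mX)
    (hinv : ∀ (g : G) (A : Set X), MeasurableSet[𝒜] A →
      MeasurableSet[𝒜] ((fun x : X => g • x) '' A))
    (C : Setoid X) (hC : @IsMeasurablePartition X mX C) (h𝒜C : Corresponds 𝒜 μ C)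
    (α : Setoid X) (hα : @IsMeasurablePartition X mX α) (hαC : condEntropy μ α C < ∞) :
    (∀ F : Finset G, F.Nonempty → condEntropy μ (joinOver α F) C < ∞) ∧
    Tendsto (meanEntropy μ α C) (moreInvariant G) (𝓝 (actionEntropy G μ α C)) ∧
    (∀ L : ℝ≥0∞, Tendsto (meanEntropy μ α C) (moreInvariant G) (𝓝 L) →
      L = actionEntropy G μ α C) ∧
    actionEntropy G μ α C = ⨅ (F : Finset G) (_ : F.Nonempty), meanEntropy μ α C F := by
  classical
  have := hμ.1
  have := moreInvariant_neBot hG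
  have hshearer := card_mul_condEntropy_joinOver_le h𝒜C hT hinv hα (G := G)
  have hlim : Tendsto (meanEntropy μ α C) (moreInvariant G)
      (𝓝 (⨅ (F : Finset G) (_ : F.Nonempty), meanEntropy μ α C F)) :=
    tendsto_average_iInf fun K F => by convert hshearer K F
  have hact : actionEntropy G μ α C = ⨅ (F : Finset G) (_ : F.Nonempty), meanEntropy μ α C F :=
    hlim.limUnder_eq
  refine ⟨fun F _ => ?_, hact ▸ hlim, fun L hL => ?_, hact⟩
  · -- Shearer's inequality for the translates of `{1}` is subadditivity
    have h := hshearer {1} F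
    rw [Finset.card_singleton, Nat.cast_one, one_mul, joinOver_singleton_one] at h
    exact h.trans_lt (ENNReal.mul_lt_top (ENNReal.natCast_lt_top _) hαC)
  · exact hact ▸ tendsto_nhds_unique hL hlim
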